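/- Let $K$ be a field, let $0\le \ell\le n$ be integers, and let $T\in K^{n\times n}$ be nilpotent. Matrices act on row vectors from the right. Notation. For a partition $\lambda=(\lambda_1\ge\dots\ge\lambda_s)$ of $n$, let $T_\lambda$ be the nilpotent matrix in Jordan canonical form with blocks of sizes $\lambda_1,\dots,\lambda_s$ (ones in positions $(j,j+1)$ inside each block), and let $B_\lambda=\mathrm{diag}(\mathrm B_{\lambda_1},\dots,\mathrm B_{\lambda_s})$, where $\mathrm B_m$ is the $m\times m$ matrix with ones on the antidiagonal and zeros elsewhere. For a matrix $A$, $\wedge_\ell A$ is the $\binom n\ell\times\binom n\ell$ matrix of its $\ell\times\ell$ minors, with rows and columns indexed by the $\ell$-subsets of $[n]$. For a vector $P=(p_I)$ indexed by $\ell$-subsets, its Hodge star $P^*=(p^*_J)$, indexed by $(n-\ell)$-subsets, is $p^*_J=\mathrm{sign}(I,J)\,p_I$ with $I=[n]\setminus J$, where $\mathrm{sign}(I,J)$ is the sign of the permutation of $[n]$ that lists $I$ and then $J$, each in increasing order. The shuffle equations of $T$ for $\ell$ are the linear forms in $P$ given by the coordinates of $P\cdot[\wedge_\ell(\mathrm{Id}_n+zT)]_i$,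 $1\le i\le \ell$, where $[\,\cdot\,]_i$ is the coefficient matrix of $z^i$. $\mathrm{Gr}(\ell,n)$ is the set of $\ell$-dimensional subspaces $L$ of $n$-dimensional row space, embedded in $\mathbb P^{\binom n\ell-1}$ by the Plücker embedding $L\mapsto P$ (maximal minors of a matrix with row space $L$), and $\mathrm{Gr}(\ell,n)^T=\{L\in \mathrm{Gr}(\ell,n): LT\subseteq L\}$. Theorem. There are a partition $\lambda$ of $n$ and $g\in GL_n(K)$ with $T=gT_\lambda g^{-1}$. For every such $\lambda$ and $g$, put $B=gB_\lambda g^{\mathrm t}$ (so $B=B_\lambda$ if $T=T_\lambda$ and $g=\mathrm{Id}_n$). Then $B$ is symmetric and invertible, and $TB=BT^{\mathrm t}$, i.e. $T$ is self-adjoint for the form $(u,v)\mapsto uBv^{\mathrm t}$. Moreover, over $K$ and over every extension field $F$ of $K$, the following hold. 1. The map $\Phi(P)=\bigl(P\cdot\wedge_\ell B\bigr)^*$ is a linear isomorphism $F^{\binom n\ell}\to F^{\binom n{n-\ell}}$, and the induced map of projective spaces carries the Plücker image of $\mathrm{Gr}(\ell,n)^T$ onto the Plücker image of $\mathrm{Gr}(n-\ell,n)^T$.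 2. $L\mapsto L^\perp=\{v: uBv^{\mathrm t}=0\text{ for all }u\in L\}$ is a bijection $\mathrm{Gr}(\ell,n)\to\mathrm{Gr}(n-\ell,n)$ which restricts to a bijection $\mathrm{Gr}(\ell,n)^T\to\mathrm{Gr}(n-\ell,n)^T$, and $\Phi$ maps the Plücker point of $L$ to the Plücker point of $L^\perp$ for every $L\in\mathrm{Gr}(\ell,n)$. 3. Substitution of $\Phi$ (i.e. $f\mapsto f\circ\Phi$) carries the linear span of the shuffle equations of $T$ for $n-\ell$ onto the linear span of the shuffle equations of $T$ for $\ell$. -/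

import Mathlib

open Matrix
open scoped LinearAlgebra.Projectivization

noncomputable section

namespace NilpotentGrassmannian

/-! ### Jordan matrices and the block antidiagonal form -/

/-- The `m × m` nilpotent Jordan block: ones in the positions `(j, j + 1)`. -/
def jordanBlock (K : Type*) [Field K] (m : ℕ) : Matrix (Fin m) (Fin m) K :=
  Matrix.of fun i j => if (i : ℕ) + 1 = (j : ℕ) then 1 else 0

/-- The `m × m` matrix with ones on the antidiagonal and zeros elsewhere
(the indices start at `0`). -/
def antidiagonalBlock (K : Type*) [Field K] (m : ℕ) : Matrix (Fin m) (Fin m) K :=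
  Matrix.of fun i j => if (i : ℕ) + (j : ℕ) + 1 = m then 1 else 0

/-- The parts of a partition `lam` of `n` in weakly decreasing order. -/
def sortedParts {n : ℕ} (lam : n.Partition) : List ℕ :=
  lam.parts.sort (fun a b => b ≤ a)

/-- The `k`-th largest part `lam_k` of the partition. -/
def part {n : ℕ} (lam : n.Partition) (k : Fin (sortedParts lam).length) : ℕ :=
  (sortedParts lam).get k

theorem sum_part {n : ℕ} (lam : n.Partition) : ∑ k, part lam k = n := by
  have h : (sortedParts lam).sum = n := by
    have h1 : ((sortedParts lam : List ℕ) : Multiset ℕ) = lam.parts :=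
      Multiset.sort_eq _ _
    rw [← Multiset.sum_coe, h1, lam.parts_sum]
  have h2 : (List.ofFn (part lam)).sum = (sortedParts lam).sum :=
    congrArg List.sum (List.ofFn_get (sortedParts lam))
  rw [← List.sum_ofFn, h2, h]

/-- Consecutive blocks of sizes `lam_1, lam_2, …`, numbered through by `0, …, n - 1`. -/
def blockIndex {n : ℕ} (lam : n.Partition) : (Σ k, Fin (part lam k)) ≃ Fin n :=
  finSigmaFinEquiv.trans (finCongr (sum_part lam))

/-- The nilpotent matrix in Jordan canonical form whose block sizes are the parts of `lam`. -/
def jordanNilpotent (K : Type*) [Field K] {n : ℕ} (lam : n.Partition) :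
    Matrix (Fin n) (Fin n) K :=
  Matrix.reindex (blockIndex lam) (blockIndex lam)
    (Matrix.blockDiagonal' fun k => jordanBlock K (part lam k))

/-- The block diagonal matrix whose blocks are antidiagonal, of sizes the parts of `lam`. -/
def blockAntidiagonal (K : Type*) [Field K] {n : ℕ} (lam : n.Partition) :
    Matrix (Fin n) (Fin n) K :=
  Matrix.reindex (blockIndex lam) (blockIndex lam)
    (Matrix.blockDiagonal' fun k => antidiagonalBlock K (part lam k))

/-! ### Exterior powers of matrices, shuffle equations and the Hodge star -/

/-- The `ℓ`-element subsets of `{0, …, n - 1}`, which index the Plücker coordinates. -/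
abbrev Idx (n ℓ : ℕ) : Type := Set.powersetCard (Fin n) ℓ

/-- The `ℓ`-subset `I` as the increasing sequence of its elements. -/
def Idx.seq {n ℓ : ℕ} (I : Idx n ℓ) : Fin ℓ ↪o Fin n :=
  Finset.orderEmbOfFin I.1 I.2

/-- The `ℓ`-th exterior power of an `n × n` matrix: the matrix of its `ℓ × ℓ` minors. -/
def wedge {R : Type*} [CommRing R] {n : ℕ} (ℓ : ℕ) (A : Matrix (Fin n) (Fin n) R) :
    Matrix (Idx n ℓ) (Idx n ℓ) R :=
  Matrix.of fun I J => (A.submatrix I.seq J.seq).det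

/-- The coefficient of `z ^ i` in the matrix of polynomials `∧_ℓ (Id + z T)`. -/
def wedgeCoeff {K : Type*} [Field K] {n : ℕ} (ℓ : ℕ) (T : Matrix (Fin n) (Fin n) K) (i : ℕ) :
    Matrix (Idx n ℓ) (Idx n ℓ) K :=
  (wedge ℓ (1 + (Polynomial.X : Polynomial K) • T.map Polynomial.C)).map fun p => p.coeff i

/-- The shuffle equations of `T`, as linear forms on the space of Plücker coordinates:
the coordinates of `P ⬝ [∧_ℓ (Id + z T)]_i` for `i = 1, …, ℓ`. -/
def shuffleEquations {K : Type*} [Field K] {n : ℕ} (ℓ : ℕ) (T : Matrix (Fin n) (Fin n) K) :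
    Set (Module.Dual K (Idx n ℓ → K)) :=
  {f | ∃ i ∈ Finset.Icc 1 ℓ, ∃ J : Idx n ℓ, ∀ P, f P = (P ᵥ* wedgeCoeff ℓ T i) J}

/-- The complementary `ℓ`-subset of an `m`-subset of `{0, …, n - 1}`, where `ℓ + m = n`. -/
def Idx.compl {n ℓ m : ℕ} (h : ℓ + m = n) (J : Idx n m) : Idx n ℓ :=
  ⟨J.1ᶜ, by
    have hJ : J.1.card = m := J.2
    change (J.1ᶜ).card = ℓ
    rw [Finset.card_compl, Fintype.card_fin]
    omega⟩

/-- The permutation of `{0, …, n - 1}` given by the sequence `(I, J)`, where `I` is the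
complement of `J` and both are listed in increasing order. -/
def shufflePerm {n ℓ m : ℕ} (h : ℓ + m = n) (J : Idx n m) : Equiv.Perm (Fin n) :=
  ((finCongr h).symm.trans finSumFinEquiv.symm).trans
    (finSumEquivOfFinset (s := (J.compl h).1) (J.compl h).2 (by
      have hJ : J.1.card = m := J.2
      change ((J.1ᶜ)ᶜ).card = m
      rw [compl_compl, hJ]))

/-- The Hodge star `P ↦ P*`, with `p*_J = sign (I, J) p_I` for `I` the complement of `J`. -/
def hodgeStar {K : Type*} [Field K] {n ℓ m : ℕ} (h : ℓ + m = n) (P : Idx n ℓ → K) :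
    Idx n m → K :=
  fun J => ((Equiv.Perm.sign (shufflePerm h J) : ℤ) : K) * P (J.compl h)

/-! ### Grassmannians and the Plücker embedding -/

/-- The `ℓ`-dimensional subspaces of `K ^ n` (row vectors). -/
def Gr (K : Type*) [Field K] (n ℓ : ℕ) : Set (Submodule K (Fin n → K)) :=
  {L | Module.finrank K L = ℓ}

/-- The `ℓ`-dimensional subspaces `L` of `K ^ n` with `L T ⊆ L`. -/
def fixedGr {K : Type*} [Field K] {n : ℕ} (ℓ : ℕ) (T : Matrix (Fin n) (Fin n) K) :
    Set (Submodule K (Fin n → K)) :=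
  {L | L ∈ Gr K n ℓ ∧ ∀ v ∈ L, v ᵥ* T ∈ L}

/-- The vector of maximal minors of an `ℓ × n` matrix. -/
def maxMinors {K : Type*} [Field K] {n ℓ : ℕ} (A : Matrix (Fin ℓ) (Fin n) K) : Idx n ℓ → K :=
  fun I => (A.submatrix id I.seq).det

theorem maxMinors_ne_zero {K : Type*} [Field K] {n ℓ : ℕ} (A : Matrix (Fin ℓ) (Fin n) K)
    (hA : LinearIndependent K A.row) : maxMinors A ≠ 0 := by
  classical
  have hr : Module.finrank K (Submodule.span K (Set.range A.col)) = ℓ := by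
    rw [← Matrix.rank_eq_finrank_span_cols, hA.rank_matrix, Fintype.card_fin]
  obtain ⟨κ, a, ha, hspan, hli⟩ := exists_linearIndependent' K A.col
  have : Finite κ := Finite.of_injective a ha
  have : Fintype κ := Fintype.ofFinite κ
  have hcard : Fintype.card κ = ℓ := by
    rw [← finrank_span_eq_card hli, hspan, hr]
  let I : Idx n ℓ := ⟨Finset.univ.image a, by
    change (Finset.univ.image a).card = ℓ
    rw [Finset.card_image_of_injective _ ha, Finset.card_univ, hcard]⟩
  intro h0
  have hdet : (A.submatrix id I.seq).det = 0 := congrFun h0 I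
  have hmem : ∀ i : Fin ℓ, ∃ k : κ, a k = I.seq i := by
    intro i
    have : I.seq i ∈ Finset.univ.image a := Finset.orderEmbOfFin_mem I.1 I.2 i
    simpa using this
  choose g hg using hmem
  have hginj : Function.Injective g := by
    intro i j hij
    apply I.seq.injective
    rw [← hg i, ← hg j, hij]
  have hli2 : LinearIndependent K (A.submatrix id I.seq).col := by
    have h2 := hli.comp g hginj
    have h3 : (A.submatrix id I.seq).col = (A.col ∘ a) ∘ g := by
      funext i j
      change A j (I.seq i) = A j (a (g i))
      rw [hg]
    rw [h3]
    exact h2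
  have hu := Matrix.linearIndependent_cols_iff_isUnit.mp hli2
  rw [Matrix.isUnit_iff_isUnit_det, hdet] at hu
  exact not_isUnit_zero hu

/-- A matrix whose rows are a basis of the `ℓ`-dimensional subspace `L`. -/
def basisMatrix {K : Type*} [Field K] {n ℓ : ℕ} (L : Gr K n ℓ) : Matrix (Fin ℓ) (Fin n) K :=
  Matrix.of fun i => (Module.finBasisOfFinrankEq K L.1 L.2 i : Fin n → K)

theorem basisMatrix_linearIndependent {K : Type*} [Field K] {n ℓ : ℕ} (L : Gr K n ℓ) :
    LinearIndependent K (basisMatrix L).row :=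
  (Module.finBasisOfFinrankEq K L.1 L.2).linearIndependent.map' L.1.subtype
    (Submodule.ker_subtype _)

/-- The Plücker embedding: the class in projective space of the maximal minors of a matrix with
row space `L`; see `plucker_eq` for the independence of the choice of this matrix. -/
def plucker {K : Type*} [Field K] {n ℓ : ℕ} (L : Gr K n ℓ) : ℙ K (Idx n ℓ → K) :=
  Projectivization.mk K (maxMinors (basisMatrix L))
    (maxMinors_ne_zero _ (basisMatrix_linearIndependent L))

theorem plucker_eq {K : Type*} [Field K] {n ℓ : ℕ} (L : Gr K n ℓ)
    (A : Matrix (Fin ℓ) (Fin n) K) (hA : LinearIndependent K A.row)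
    (hL : Submodule.span K (Set.range A.row) = L.1) :
    plucker L = Projectivization.mk K (maxMinors A) (maxMinors_ne_zero A hA) := by
  have hmem : ∀ i, A.row i ∈ L.1 := fun i => hL ▸ Submodule.subset_span ⟨i, rfl⟩
  let b := Module.finBasisOfFinrankEq K L.1 L.2
  let C : Matrix (Fin ℓ) (Fin ℓ) K := Matrix.of fun i j => b.repr ⟨A.row i, hmem i⟩ j
  have hAC : A = C * basisMatrix L := by
    ext i j
    have h := congrArg (fun v : L.1 => (v : Fin n → K) j) (b.sum_repr ⟨A.row i, hmem i⟩)
    simp only [Submodule.coe_sum, Finset.sum_apply, Submodule.coe_smul, Pi.smul_apply,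
      smul_eq_mul] at h
    rw [Matrix.mul_apply]
    exact h.symm
  have hm : maxMinors A = C.det • maxMinors (basisMatrix L) := by
    funext I
    have h1 : A.submatrix id I.seq = C * (basisMatrix L).submatrix id I.seq := by
      rw [hAC]
      rfl
    simp only [maxMinors, Pi.smul_apply, smul_eq_mul]
    rw [h1, Matrix.det_mul]
  have hC : C.det ≠ 0 := by
    intro h0
    apply maxMinors_ne_zero A hA
    rw [hm, h0, zero_smul]
  symm
  unfold plucker
  rw [Projectivization.mk_eq_mk_iff']
  exact ⟨C.det, hm.symm⟩

/-- The fixed point locus of `T` as a subset of the projective space of Plücker coordinates. -/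
def fixedVariety {K : Type*} [Field K] {n : ℕ} (ℓ : ℕ) (T : Matrix (Fin n) (Fin n) K) :
    Set (ℙ K (Idx n ℓ → K)) :=
  plucker '' {L : Gr K n ℓ | L.1 ∈ fixedGr ℓ T}

/-- The orthogonal space `{v | u B vᵗ = 0 for all u ∈ L}`. -/
def orth {K : Type*} [Field K] {n : ℕ} (B : Matrix (Fin n) (Fin n) K)
    (L : Submodule K (Fin n → K)) : Submodule K (Fin n → K) :=
  (Matrix.toBilin' B).orthogonal L

end NilpotentGrassmannian

end

open NilpotentGrassmannian

/-!
If `T` is self-adjoint for the symmetric form `B`, then `L ↦ L^⊥` is an involution respecting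
`T`-invariance. It is linear in Plücker coordinates: if the rows of `D` are orthogonal to those of
`C`, then by Laplace expansion the maximal minors of `D` are, up to sign and a common factor, the
complementary maximal minors of `C`; applied to `A B`, for `A` with row space `L`, this says that
`Φ` takes the point of `L` to that of `L^⊥`.

The shuffle equations cut out the space of all `P` with `P ⬝ ∧_ℓ (Id + z T) = P`. By Cauchy–Binet
and Laplace, the Hodge star of `P ⬝ ∧_ℓ A`, multiplied by `∧_{n-ℓ} Aᵗ`, is `det A` times the Hodge
star of `P`. As `det (Id + z T) = 1` and `Id + z T` is again self-adjoint for `B`, it follows that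
`Φ` identifies these spaces for `ℓ` and `n - ℓ`, hence also the spans of linear forms that they
annihilate.

`T_λ` is self-adjoint for `B_λ` because reversing the order of a Jordan chain transposes a Jordan
block, and the Jordan form of `T` is the decomposition of `K ^ n`, on which `X` acts through `T`, as
a torsion module over `K[X]`.
-/

namespace NilpotentGrassmannian

section Minors

variable {R : Type*} [CommRing R] {n ℓ : ℕ}

/-- The vector of maximal minors of an `ℓ × n` matrix over a commutative ring: `maxMinors` without
the restriction to fields, so that it applies to matrices of polynomials. -/
def minors (A : Matrix (Fin ℓ) (Fin n) R) : Idx n ℓ → R :=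
  fun I => (A.submatrix id I.seq).det

/-- The matrix whose rows are the coordinate vectors indexed by `I`, in increasing order. -/
def coordRows (R : Type*) [CommRing R] (I : Idx n ℓ) : Matrix (Fin ℓ) (Fin n) R :=
  (1 : Matrix (Fin n) (Fin n) R).submatrix I.seq id

theorem coordRows_mul {κ : Type*} (I : Idx n ℓ) (A : Matrix (Fin n) κ R) :
    coordRows R I * A = A.submatrix I.seq id :=
  one_submatrix_mul I.seq (Equiv.refl _) A

theorem minors_coordRows_mul (I : Idx n ℓ) (A : Matrix (Fin n) (Fin n) R) :
    minors (coordRows R I * A) = wedge ℓ A I := by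
  rw [coordRows_mul]
  rfl

theorem basisFun_exteriorPower_repr_ιMulti (A : Matrix (Fin ℓ) (Fin n) R) (I : Idx n ℓ) :
    ((Pi.basisFun R (Fin n)).exteriorPower ℓ).repr (exteriorPower.ιMulti R ℓ A.row) I
      = minors A I := by
  rw [exteriorPower.basis_repr_apply, exteriorPower.ιMultiDual_apply_ιMulti]
  rfl

theorem basisFun_exteriorPower_apply (I : Idx n ℓ) :
    (Pi.basisFun R (Fin n)).exteriorPower ℓ I = exteriorPower.ιMulti R ℓ (coordRows R I).row := by
  rw [exteriorPower.basis_apply, exteriorPower.ιMulti_family]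
  congr 1
  funext i
  exact (Pi.basisFun_apply R (Fin n) _).trans (funext fun j => one_eq_pi_single.symm)

theorem minors_coordRows (I : Idx n ℓ) : minors (coordRows R I) = Pi.single I 1 := by
  funext J
  rw [← basisFun_exteriorPower_repr_ιMulti, ← basisFun_exteriorPower_apply, Module.Basis.repr_self,
    Finsupp.single_eq_pi_single]

theorem alternatingMap_row_eq_sum_minors_smul {M : Type*} [AddCommGroup M] [Module R M]
    (g : (Fin n → R) [⋀^Fin ℓ]→ₗ[R] M) (A : Matrix (Fin ℓ) (Fin n) R) :
    g A.row = ∑ I, minors A I • g (coordRows R I).row := by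
  have hA := ((Pi.basisFun R (Fin n)).exteriorPower ℓ).sum_repr (exteriorPower.ιMulti R ℓ A.row)
  simpa only [map_sum, map_smul, basisFun_exteriorPower_repr_ιMulti, basisFun_exteriorPower_apply,
    exteriorPower.alternatingMapLinearEquiv_apply_ιMulti]
    using (congrArg (exteriorPower.alternatingMapLinearEquiv g) hA).symm

theorem minors_mul (C : Matrix (Fin ℓ) (Fin n) R) (A : Matrix (Fin n) (Fin n) R) :
    minors (C * A) = minors C ᵥ* wedge ℓ A := by
  funext K
  let g : (Fin n → R) [⋀^Fin ℓ]→ₗ[R] R :=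
    detRowAlternating.compLinearMap (A.submatrix id K.seq).vecMulLinear
  have hg (C : Matrix (Fin ℓ) (Fin n) R) : g C.row = minors (C * A) K := rfl
  calc minors (C * A) K = ∑ I, minors C I • minors (coordRows R I * A) K := by
        simpa only [hg] using alternatingMap_row_eq_sum_minors_smul g C
    _ = (minors C ᵥ* wedge ℓ A) K := by
        simp only [minors_coordRows_mul, smul_eq_mul, vecMul, dotProduct]

theorem wedge_one : wedge ℓ (1 : Matrix (Fin n) (Fin n) R) = 1 := by
  funext I
  rw [← minors_coordRows_mul, Matrix.mul_one, minors_coordRows]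
  funext J
  rw [Matrix.one_eq_pi_single]

theorem wedge_mul (A B : Matrix (Fin n) (Fin n) R) :
    wedge ℓ (A * B) = wedge ℓ A * wedge ℓ B := by
  funext I
  rw [← minors_coordRows_mul, ← Matrix.mul_assoc, minors_mul, minors_coordRows_mul,
    mul_apply_eq_vecMul]

theorem isUnit_wedge {A : Matrix (Fin n) (Fin n) R} (hA : IsUnit A) : IsUnit (wedge ℓ A) := by
  let wedgeHom : Matrix (Fin n) (Fin n) R →* Matrix (Idx n ℓ) (Idx n ℓ) R :=
    { toFun := wedge ℓ, map_one' := wedge_one, map_mul' := wedge_mul }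
  exact hA.map wedgeHom

theorem wedge_transpose (A : Matrix (Fin n) (Fin n) R) : wedge ℓ Aᵀ = (wedge ℓ A)ᵀ := by
  ext I J
  exact det_transpose (A.submatrix J.seq I.seq)

theorem wedge_map {S : Type*} [CommRing S] (f : R →+* S) (A : Matrix (Fin n) (Fin n) R) :
    wedge ℓ (A.map f) = (wedge ℓ A).map f := by
  ext I J
  exact (f.map_det (A.submatrix I.seq J.seq)).symm

end Minors

section HodgeStar

variable {R : Type*} [CommRing R] {n ℓ m : ℕ}

/-- Complementation of index sets as an equivalence. -/
def Idx.complEquiv (h : ℓ + m = n) : Idx n m ≃ Idx n ℓ :=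
  Set.powersetCard.compl (h.trans (Fintype.card_fin n).symm)

/-- The Hodge star over a commutative ring, as a linear isomorphism. -/
noncomputable def hodgeStarEquiv (R : Type*) [CommRing R] (h : ℓ + m = n) :
    (Idx n ℓ → R) ≃ₗ[R] (Idx n m → R) :=
  LinearEquiv.funCongrLeft R R (Idx.complEquiv h) ≪≫ₗ
    LinearEquiv.piCongrRight fun J => LinearEquiv.smulOfUnit
      (Units.map (Int.castRingHom R : ℤ →* R) (Equiv.Perm.sign (shufflePerm h J)))

theorem hodgeStarEquiv_apply (h : ℓ + m = n) (P : Idx n ℓ → R) (J : Idx n m) :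
    hodgeStarEquiv R h P J = ((Equiv.Perm.sign (shufflePerm h J) : ℤ) : R) * P (J.compl h) :=
  rfl

/-- The decomposition of `{0, …, n - 1}` into the first `ℓ` and the last `m` indices. -/
def splitIndex (h : ℓ + m = n) : Fin n ≃ Fin ℓ ⊕ Fin m :=
  (finCongr h).symm.trans finSumFinEquiv.symm

theorem shufflePerm_splitIndex_symm_inl (h : ℓ + m = n) (J : Idx n m) (i : Fin ℓ) :
    shufflePerm h J ((splitIndex h).symm (Sum.inl i)) = (J.compl h).seq i := by
  rw [← Equiv.trans_apply, splitIndex, shufflePerm, ← Equiv.trans_assoc, Equiv.symm_trans_self]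
  rfl

theorem shufflePerm_splitIndex_symm_inr (h : ℓ + m = n) (J : Idx n m) (i : Fin m) :
    shufflePerm h J ((splitIndex h).symm (Sum.inr i)) = J.seq i := by
  simp [shufflePerm, splitIndex, Idx.seq, Idx.compl]

/-- The square matrix with the rows of `C` followed by the rows of `D`. -/
def stack {α : Type*} (h : ℓ + m = n) (C : Matrix (Fin ℓ) (Fin n) α)
    (D : Matrix (Fin m) (Fin n) α) : Matrix (Fin n) (Fin n) α :=
  (fromRows C D).submatrix (splitIndex h) id

theorem stack_mul (h : ℓ + m = n) (C : Matrix (Fin ℓ) (Fin n) R) (D : Matrix (Fin m) (Fin n) R)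
    (A : Matrix (Fin n) (Fin n) R) : stack h C D * A = stack h (C * A) (D * A) := by
  rw [stack, stack, ← fromRows_mul]
  rfl

theorem stack_mul_transpose_stack (h : ℓ + m = n) (C C' : Matrix (Fin ℓ) (Fin n) R)
    (D D' : Matrix (Fin m) (Fin n) R) :
    stack h C D * (stack h C' D')ᵀ
      = (fromBlocks (C * C'ᵀ) (C * D'ᵀ) (D * C'ᵀ) (D * D'ᵀ)).submatrix
          (splitIndex h) (splitIndex h) := by
  rw [stack, stack, transpose_submatrix, ← submatrix_mul _ _ _ id _ Function.bijective_id,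
    transpose_fromRows, fromRows_mul_fromCols]

theorem stack_updateRow {α : Type*} (h : ℓ + m = n) (C : Matrix (Fin ℓ) (Fin n) α)
    (D : Matrix (Fin m) (Fin n) α) (i : Fin ℓ) (x : Fin n → α) :
    stack h (C.updateRow i x) D = (stack h C D).updateRow ((splitIndex h).symm (Sum.inl i)) x := by
  ext j k
  obtain ⟨j | j, rfl⟩ := (splitIndex h).symm.surjective j <;>
    simp [stack, updateRow_apply]

theorem stack_submatrix_shufflePerm {α : Type*} (h : ℓ + m = n) (J : Idx n m)
    (C : Matrix (Fin ℓ) (Fin n) α) (D : Matrix (Fin m) (Fin n) α) :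
    (stack h C D).submatrix id (shufflePerm h J)
      = (fromBlocks (C.submatrix id (J.compl h).seq) (C.submatrix id J.seq)
          (D.submatrix id (J.compl h).seq) (D.submatrix id J.seq)).submatrix
          (splitIndex h) (splitIndex h) := by
  ext i j
  obtain ⟨i | i, rfl⟩ := (splitIndex h).symm.surjective i <;>
    obtain ⟨j | j, rfl⟩ := (splitIndex h).symm.surjective j <;>
    simp [stack, shufflePerm_splitIndex_symm_inl, shufflePerm_splitIndex_symm_inr]

theorem coordRows_submatrix_seq (I : Idx n ℓ) : (coordRows R I).submatrix id I.seq = 1 :=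
  submatrix_one _ I.seq.injective

theorem coordRows_compl_submatrix_seq (h : ℓ + m = n) (J : Idx n m) :
    (coordRows R (J.compl h)).submatrix id J.seq = 0 := by
  ext i j
  refine one_apply_ne ?_
  rw [← shufflePerm_splitIndex_symm_inl, ← shufflePerm_splitIndex_symm_inr h]
  exact ((shufflePerm h J).injective.comp (splitIndex h).symm.injective).ne Sum.inl_ne_inr

theorem det_stack_coordRows_compl (h : ℓ + m = n) (J : Idx n m) (D : Matrix (Fin m) (Fin n) R) :
    (stack h (coordRows R (J.compl h)) D).det
      = ((Equiv.Perm.sign (shufflePerm h J) : ℤ) : R) * minors D J := by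
  have hperm : minors D J = ((Equiv.Perm.sign (shufflePerm h J) : ℤ) : R)
      * (stack h (coordRows R (J.compl h)) D).det := by
    rw [← det_permute', stack_submatrix_shufflePerm, coordRows_submatrix_seq,
      coordRows_compl_submatrix_seq, det_submatrix_equiv_self, det_fromBlocks_zero₁₂, det_one,
      one_mul, minors]
  rw [hperm, ← mul_assoc, ← Int.cast_mul, Int.units_coe_mul_self, Int.cast_one, one_mul]

theorem det_stack_update (h : ℓ + m = n) (C : Fin ℓ → Fin n → R) (D : Matrix (Fin m) (Fin n) R)
    (i : Fin ℓ) (x : Fin n → R) :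
    (stack h (of (Function.update C i x)) D).det
      = ((stack h (of C) D).updateRow ((splitIndex h).symm (Sum.inl i)) x).det :=
  congrArg det (stack_updateRow h (of C) D i x)

/-- The determinant of `stack h C D` as an alternating map of the rows of `C`, to which
`alternatingMap_row_eq_sum_minors_smul` applies. -/
def detStackAlternating (h : ℓ + m = n) (D : Matrix (Fin m) (Fin n) R) :
    (Fin n → R) [⋀^Fin ℓ]→ₗ[R] R where
  toMultilinearMap := MultilinearMap.mk' (fun C => (stack h (of C) D).det)
    (fun C i x y => by simp only [det_stack_update, det_updateRow_add])
    (fun C i c x => by simp only [det_stack_update, det_updateRow_smul, smul_eq_mul])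
  map_eq_zero_of_eq' C i j hij hne := by
    refine det_zero_of_row_eq ((splitIndex h).symm.injective.ne (Sum.inl_injective.ne hne)) ?_
    simpa [stack, funext_iff] using hij

theorem hodgeStarEquiv_minors_dotProduct_minors (h : ℓ + m = n) (C : Matrix (Fin ℓ) (Fin n) R)
    (D : Matrix (Fin m) (Fin n) R) :
    hodgeStarEquiv R h (minors C) ⬝ᵥ minors D = (stack h C D).det := by
  calc hodgeStarEquiv R h (minors C) ⬝ᵥ minors D
      = ∑ J : Idx n m, minors C (J.compl h) * (stack h (coordRows R (J.compl h)) D).det := by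
        refine Finset.sum_congr rfl fun J _ => ?_
        rw [hodgeStarEquiv_apply, det_stack_coordRows_compl]
        ring
    _ = ∑ I : Idx n ℓ, minors C I * (stack h (coordRows R I) D).det :=
        (Idx.complEquiv h).sum_comp fun I => minors C I * (stack h (coordRows R I) D).det
    _ = (stack h C D).det :=
        (alternatingMap_row_eq_sum_minors_smul (detStackAlternating h D) C).symm

theorem hodgeStarEquiv_vecMul_wedge (h : ℓ + m = n) (A : Matrix (Fin n) (Fin n) R)
    (P : Idx n ℓ → R) :
    hodgeStarEquiv R h (P ᵥ* wedge ℓ A) ᵥ* wedge m Aᵀ = A.det • hodgeStarEquiv R h P := by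
  suffices hs : (wedge m Aᵀ).vecMulLinear ∘ₗ (hodgeStarEquiv R h).toLinearMap ∘ₗ
      (wedge ℓ A).vecMulLinear = A.det • (hodgeStarEquiv R h).toLinearMap from
    LinearMap.congr_fun hs P
  refine (Pi.basisFun R _).ext fun I => funext fun J => ?_
  simp only [LinearMap.comp_apply, LinearEquiv.coe_coe, coe_vecMulLinear, LinearMap.smul_apply,
    Pi.basisFun_apply, ← minors_coordRows]
  calc (hodgeStarEquiv R h (minors (coordRows R I) ᵥ* wedge ℓ A) ᵥ* wedge m Aᵀ) J
      = hodgeStarEquiv R h (minors (coordRows R I * A)) ⬝ᵥ minors (coordRows R J * A) := by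
        rw [minors_mul, minors_coordRows_mul, wedge_transpose, vecMul_transpose, mulVec,
          dotProduct_comm]
    _ = A.det * (stack h (coordRows R I) (coordRows R J)).det := by
        rw [hodgeStarEquiv_minors_dotProduct_minors, ← stack_mul, det_mul, mul_comm]
    _ = (A.det • hodgeStarEquiv R h (minors (coordRows R I))) J := by
        rw [← hodgeStarEquiv_minors_dotProduct_minors, minors_coordRows J, dotProduct_single_one,
          Pi.smul_apply, smul_eq_mul]

end HodgeStar

section Duality

variable {R : Type*} [CommRing R] {n ℓ m : ℕ}

/-- The linear isomorphism `P ↦ (P ⬝ ∧_ℓ B)*` of spaces of Plücker coordinates. -/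
noncomputable def dualityEquiv (h : ℓ + m = n) {B : Matrix (Fin n) (Fin n) R} (hB : IsUnit B) :
    (Idx n ℓ → R) ≃ₗ[R] (Idx n m → R) :=
  LinearEquiv.ofBijective (wedge ℓ B).vecMulLinear
    ⟨vecMul_injective_of_isUnit (isUnit_wedge hB),
      vecMul_surjective_iff_isUnit.2 (isUnit_wedge hB)⟩ ≪≫ₗ hodgeStarEquiv R h

theorem dualityEquiv_apply (h : ℓ + m = n) {B : Matrix (Fin n) (Fin n) R} (hB : IsUnit B)
    (P : Idx n ℓ → R) : dualityEquiv h hB P = hodgeStarEquiv R h (P ᵥ* wedge ℓ B) := rfl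

theorem dualityEquiv_map {S : Type*} [CommRing S] (f : R →+* S) (h : ℓ + m = n)
    {B : Matrix (Fin n) (Fin n) R} (hB : IsUnit B) (hfB : IsUnit (B.map f)) (P : Idx n ℓ → R) :
    dualityEquiv h hfB (f ∘ P) = f ∘ dualityEquiv h hB P := by
  funext J
  simp only [dualityEquiv_apply, hodgeStarEquiv_apply, wedge_map, Function.comp_apply, map_mul,
    map_intCast, RingHom.map_vecMul]

theorem dualityEquiv_vecMul_wedge (h : ℓ + m = n) {A B : Matrix (Fin n) (Fin n) R}
    (hB : IsUnit B) (hAB : A * B = B * Aᵀ) (P : Idx n ℓ → R) :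
    dualityEquiv h hB (P ᵥ* wedge ℓ A) ᵥ* wedge m A = A.det • dualityEquiv h hB P := by
  rw [dualityEquiv_apply, dualityEquiv_apply, vecMul_vecMul, ← wedge_mul, hAB, wedge_mul,
    ← vecMul_vecMul]
  simpa only [transpose_transpose, det_transpose]
    using hodgeStarEquiv_vecMul_wedge h Aᵀ (P ᵥ* wedge ℓ B)

theorem dualityEquiv_vecMul_wedge_eq_iff (h : ℓ + m = n) {A B : Matrix (Fin n) (Fin n) R}
    (hB : IsUnit B) (hAB : A * B = B * Aᵀ) (hA : A.det = 1) (P : Idx n ℓ → R) :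
    dualityEquiv h hB P ᵥ* wedge m A = dualityEquiv h hB P ↔ P ᵥ* wedge ℓ A = P := by
  have hinv := dualityEquiv_vecMul_wedge h hB hAB P
  rw [hA, one_smul] at hinv
  have hunit : IsUnit (wedge m A) :=
    isUnit_wedge ((isUnit_iff_isUnit_det A).2 (hA ▸ isUnit_one))
  nth_rw 2 [← hinv]
  rw [(vecMul_injective_of_isUnit hunit).eq_iff, (dualityEquiv h hB).injective.eq_iff, eq_comm]

theorem det_stack_smul_hodgeStarEquiv_minors (h : ℓ + m = n) {C : Matrix (Fin ℓ) (Fin n) R}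
    {D : Matrix (Fin m) (Fin n) R} {Y : Matrix (Fin n) (Fin ℓ) R} (hCD : C * Dᵀ = 0)
    (hCY : C * Y = 1) : (stack h Yᵀ D).det • hodgeStarEquiv R h (minors C) = minors D := by
  funext J
  have hJ : hodgeStarEquiv R h (minors C) J = (stack h C (coordRows R J)).det := by
    rw [← hodgeStarEquiv_minors_dotProduct_minors, minors_coordRows, dotProduct_single_one]
  rw [Pi.smul_apply, smul_eq_mul, hJ, mul_comm, ← det_transpose (stack h Yᵀ D), ← det_mul,
    stack_mul_transpose_stack, hCD, transpose_transpose, hCY, det_submatrix_equiv_self,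
    det_fromBlocks_zero₁₂, det_one, one_mul, coordRows_mul]
  exact det_transpose (D.submatrix id J.seq)

variable {F : Type*} [Field F]

theorem mem_orth {B : Matrix (Fin n) (Fin n) F} {L : Submodule F (Fin n → F)} {v : Fin n → F} :
    v ∈ orth B L ↔ ∀ u ∈ L, (u ᵥ* B) ⬝ᵥ v = 0 := by
  simp only [orth, LinearMap.BilinForm.mem_orthogonal_iff, toBilin'_apply', dotProduct_mulVec]

theorem toBilin'_nondegenerate {B : Matrix (Fin n) (Fin n) F} (hB : IsUnit B) :
    (toBilin' B).Nondegenerate := by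
  rw [LinearMap.BilinForm.nondegenerate_toBilin'_iff_det_ne_zero]
  exact ((isUnit_iff_isUnit_det B).1 hB).ne_zero

theorem orth_mem_Gr (h : ℓ + m = n) {B : Matrix (Fin n) (Fin n) F} (hB : IsUnit B)
    {L : Submodule F (Fin n → F)} (hL : L ∈ Gr F n ℓ) : orth B L ∈ Gr F n m := by
  change Module.finrank F (orth B L) = m
  rw [orth, LinearMap.BilinForm.finrank_orthogonal (toBilin'_nondegenerate hB),
    Module.finrank_fin_fun, show Module.finrank F L = ℓ from hL]
  omega

theorem orth_orth {B : Matrix (Fin n) (Fin n) F} (hB : IsUnit B) (hs : B.IsSymm)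
    (L : Submodule F (Fin n → F)) : orth B (orth B L) = L := by
  refine LinearMap.BilinForm.orthogonal_orthogonal (toBilin'_nondegenerate hB) ?_ L
  intro u v huv
  rw [toBilin'_apply'] at huv ⊢
  rwa [dotProduct_mulVec, ← mulVec_transpose, hs, dotProduct_comm]

theorem orth_mem_fixedGr (h : ℓ + m = n) {T B : Matrix (Fin n) (Fin n) F} (hB : IsUnit B)
    (hTB : T * B = B * Tᵀ) {L : Submodule F (Fin n → F)} (hL : L ∈ fixedGr ℓ T) :
    orth B L ∈ fixedGr m T := by
  refine ⟨orth_mem_Gr h hB hL.1, fun v hv => ?_⟩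
  rw [mem_orth] at hv ⊢
  intro u hu
  rw [← mulVec_transpose T, dotProduct_mulVec, vecMul_vecMul, ← hTB, ← vecMul_vecMul]
  exact hv _ (hL.2 u hu)

theorem bijOn_orth_Gr (h : ℓ + m = n) {B : Matrix (Fin n) (Fin n) F} (hB : IsUnit B)
    (hs : B.IsSymm) : Set.BijOn (orth B) (Gr F n ℓ) (Gr F n m) :=
  Set.InvOn.bijOn (f' := orth B)
    ⟨fun L _ => orth_orth hB hs L, fun L _ => orth_orth hB hs L⟩
    (fun _ hL => orth_mem_Gr h hB hL)
    (fun _ hL => orth_mem_Gr ((add_comm m ℓ).trans h) hB hL)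

theorem bijOn_orth_fixedGr (h : ℓ + m = n) {T B : Matrix (Fin n) (Fin n) F} (hB : IsUnit B)
    (hs : B.IsSymm) (hTB : T * B = B * Tᵀ) : Set.BijOn (orth B) (fixedGr ℓ T) (fixedGr m T) :=
  Set.InvOn.bijOn (f' := orth B)
    ⟨fun L _ => orth_orth hB hs L, fun L _ => orth_orth hB hs L⟩
    (fun _ hL => orth_mem_fixedGr h hB hTB hL)
    (fun _ hL => orth_mem_fixedGr ((add_comm m ℓ).trans h) hB hTB hL)

theorem exists_mul_eq_one_of_linearIndependent_row {A : Matrix (Fin ℓ) (Fin n) F}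
    (hA : LinearIndependent F A.row) : ∃ Y : Matrix (Fin n) (Fin ℓ) F, A * Y = 1 := by
  refine mulVec_surjective_iff_exists_right_inverse.1 ?_
  refine LinearMap.range_eq_top (f := A.mulVecLin).1 (Submodule.eq_top_of_finrank_eq ?_)
  rw [Module.finrank_fin_fun]
  exact hA.rank_matrix.trans (Fintype.card_fin ℓ)

theorem basisMatrix_row_mem (L : Gr F n ℓ) (i : Fin ℓ) : (basisMatrix L).row i ∈ L.1 :=
  (Module.finBasisOfFinrankEq F L.1 L.2 i).2

theorem map_dualityEquiv_plucker (h : ℓ + m = n) {B : Matrix (Fin n) (Fin n) F} (hB : IsUnit B)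
    (L : Gr F n ℓ) :
    Projectivization.map (dualityEquiv h hB).toLinearMap (dualityEquiv h hB).injective
      (plucker L) = plucker ⟨orth B L.1, orth_mem_Gr h hB L.2⟩ := by
  set L' : Gr F n m := ⟨orth B L.1, orth_mem_Gr h hB L.2⟩
  set A := basisMatrix L
  set D := basisMatrix L'
  obtain ⟨Y, hAY⟩ := exists_mul_eq_one_of_linearIndependent_row (basisMatrix_linearIndependent L)
  have hABY : A * B * (B⁻¹ * Y) = 1 := by
    rw [Matrix.mul_assoc, mul_nonsing_inv_cancel_left _ _ ((isUnit_iff_isUnit_det B).1 hB), hAY]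
  have hABD : A * B * Dᵀ = 0 := by
    ext i j
    exact mem_orth.1 (basisMatrix_row_mem L' j) (A i) (basisMatrix_row_mem L i)
  have hAD : (stack h (B⁻¹ * Y)ᵀ D).det • dualityEquiv h hB (minors A) = minors D := by
    rw [dualityEquiv_apply, ← minors_mul, det_stack_smul_hodgeStarEquiv_minors h hABD hABY]
  rw [plucker, plucker, Projectivization.map_mk, eq_comm, Projectivization.mk_eq_mk_iff']
  exact ⟨_, hAD⟩

theorem map_dualityEquiv_fixedVariety (h : ℓ + m = n) {T B : Matrix (Fin n) (Fin n) F}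
    (hB : IsUnit B) (hs : B.IsSymm) (hTB : T * B = B * Tᵀ) :
    Projectivization.map (dualityEquiv h hB).toLinearMap (dualityEquiv h hB).injective ''
      fixedVariety ℓ T = fixedVariety m T := by
  ext x
  constructor
  · rintro ⟨_, ⟨L, hL, rfl⟩, rfl⟩
    exact ⟨_, orth_mem_fixedGr h hB hTB hL, (map_dualityEquiv_plucker h hB L).symm⟩
  · rintro ⟨⟨_, hL'⟩, hfix, rfl⟩
    obtain ⟨L, hL, rfl⟩ := (bijOn_orth_fixedGr h hB hs hTB).surjOn hfix
    exact ⟨_, ⟨⟨L, hL.1⟩, hL, rfl⟩, map_dualityEquiv_plucker h hB ⟨L, hL.1⟩⟩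

end Duality

section Shuffle

open Polynomial

section Pencil

variable {R : Type*} [CommRing R] {n : ℕ}

/-- The matrix `Id + z T` of polynomials. -/
noncomputable abbrev pencil (T : Matrix (Fin n) (Fin n) R) : Matrix (Fin n) (Fin n) R[X] :=
  1 + (X : R[X]) • T.map C

theorem det_pencil_eq_charpolyRev_neg (T : Matrix (Fin n) (Fin n) R) :
    (pencil T).det = (-T).charpolyRev := by
  have hneg : (-T).map (C : R → R[X]) = -T.map C := Matrix.map_neg C (map_neg C) T
  rw [charpolyRev, hneg, smul_neg, sub_neg_eq_add]

theorem det_pencil_eq_one [IsReduced R] {T : Matrix (Fin n) (Fin n) R} (hT : IsNilpotent T) :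
    (pencil T).det = 1 := by
  rw [det_pencil_eq_charpolyRev_neg]
  have hunit : IsUnit (-T).charpolyRev := isUnit_charpolyRev_of_isNilpotent hT.neg
  have hcoeff (i : ℕ) (hi : i ≠ 0) : (-T).charpolyRev.coeff i = 0 :=
    ((Polynomial.isUnit_iff_coeff_isUnit_isNilpotent.1 hunit).2 i hi).eq_zero
  have hconst : (-T).charpolyRev.coeff 0 = 1 := by
    rw [coeff_zero_eq_eval_zero, eval_charpolyRev]
  ext i
  rcases eq_or_ne i 0 with rfl | hi
  · rw [hconst, coeff_one_zero]
  · rw [hcoeff i hi, coeff_one, if_neg hi]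

theorem pencil_submatrix {ι κ : Type*} (T : Matrix (Fin n) (Fin n) R) (r : ι → Fin n)
    (c : κ → Fin n) :
    (pencil T).submatrix r c = (X : R[X]) • (T.submatrix r c).map C
      + ((1 : Matrix (Fin n) (Fin n) R).submatrix r c).map C := by
  rw [add_comm, ← submatrix_map, ← submatrix_map, Matrix.map_one C C_0 C_1]
  rfl

theorem pencil_mul_map_C {T B : Matrix (Fin n) (Fin n) R} (hTB : T * B = B * Tᵀ) :
    pencil T * B.map C = B.map C * (pencil T)ᵀ := by
  have hC : T.map C * B.map C = B.map C * Tᵀ.map (C : R → R[X]) := by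
    rw [← Matrix.map_mul, hTB, Matrix.map_mul]
  rw [pencil, add_mul, one_mul, smul_mul, hC, transpose_add, transpose_one, transpose_smul,
    transpose_map, mul_add, mul_one, Matrix.mul_smul]

end Pencil

variable {F : Type*} [Field F] {n ℓ m : ℕ}

theorem wedgeCoeff_zero (T : Matrix (Fin n) (Fin n) F) : wedgeCoeff ℓ T 0 = 1 := by
  ext I J
  change ((pencil T).submatrix I.seq J.seq).det.coeff 0 = _
  rw [pencil_submatrix, coeff_det_X_add_C_zero, ← wedge_one (ℓ := ℓ), wedge, of_apply]

theorem wedgeCoeff_eq_zero (T : Matrix (Fin n) (Fin n) F) {i : ℕ} (hi : ℓ < i) :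
    wedgeCoeff ℓ T i = 0 := by
  ext I J
  change ((pencil T).submatrix I.seq J.seq).det.coeff i = 0
  rw [pencil_submatrix]
  refine coeff_eq_zero_of_natDegree_lt ((natDegree_det_X_add_C_le _ _).trans_lt ?_)
  rwa [Fintype.card_fin]

theorem coeff_vecMul_wedge_pencil (T : Matrix (Fin n) (Fin n) F) (P : Idx n ℓ → F) (i : ℕ)
    (J : Idx n ℓ) :
    (((C ∘ P) ᵥ* wedge ℓ (pencil T)) J).coeff i = (P ᵥ* wedgeCoeff ℓ T i) J := by
  simp only [vecMul, dotProduct, finsetSum_coeff, Function.comp_apply, coeff_C_mul]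
  rfl

theorem mem_dualCoannihilator_span_shuffleEquations {T : Matrix (Fin n) (Fin n) F}
    {P : Idx n ℓ → F} :
    P ∈ (Submodule.span F (shuffleEquations ℓ T)).dualCoannihilator ↔
      (C ∘ P) ᵥ* wedge ℓ (pencil T) = C ∘ P := by
  rw [← SetLike.mem_coe, Submodule.coe_dualCoannihilator_span]
  constructor
  · intro hP
    funext J
    ext i
    rw [coeff_vecMul_wedge_pencil, Function.comp_apply]
    rcases Nat.eq_zero_or_pos i with rfl | hi
    · rw [wedgeCoeff_zero, vecMul_one, coeff_C_zero]
    · rw [coeff_C_of_ne_zero hi.ne']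
      rcases le_or_gt i ℓ with hiℓ | hiℓ
      · exact hP (LinearMap.proj J ∘ₗ (wedgeCoeff ℓ T i).vecMulLinear)
          ⟨i, Finset.mem_Icc.2 ⟨hi, hiℓ⟩, J, fun _ => rfl⟩
      · rw [wedgeCoeff_eq_zero T hiℓ, vecMul_zero, Pi.zero_apply]
  · rintro hP f ⟨i, hi, J, hf⟩
    have hi0 : i ≠ 0 := Nat.one_le_iff_ne_zero.1 (Finset.mem_Icc.1 hi).1
    rw [hf, ← coeff_vecMul_wedge_pencil, hP, Function.comp_apply, coeff_C_of_ne_zero hi0]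

theorem dualityEquiv_mem_dualCoannihilator_iff (h : ℓ + m = n) {T B : Matrix (Fin n) (Fin n) F}
    (hT : IsNilpotent T) (hB : IsUnit B) (hTB : T * B = B * Tᵀ) (P : Idx n ℓ → F) :
    dualityEquiv h hB P ∈ (Submodule.span F (shuffleEquations m T)).dualCoannihilator ↔
      P ∈ (Submodule.span F (shuffleEquations ℓ T)).dualCoannihilator := by
  have hBC : IsUnit (B.map (C : F →+* F[X])) := hB.map (C : F →+* F[X]).mapMatrix
  rw [mem_dualCoannihilator_span_shuffleEquations, mem_dualCoannihilator_span_shuffleEquations,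
    ← dualityEquiv_map C h hB hBC,
    dualityEquiv_vecMul_wedge_eq_iff h hBC (pencil_mul_map_C hTB) (det_pencil_eq_one hT)]

theorem dualCoannihilator_map_dualMap {K V W : Type*} [CommSemiring K] [AddCommMonoid V]
    [Module K V] [AddCommMonoid W] [Module K W] (f : V →ₗ[K] W)
    (S : Submodule K (Module.Dual K W)) :
    (S.map f.dualMap).dualCoannihilator = S.dualCoannihilator.comap f := by
  ext v
  simp only [Submodule.mem_dualCoannihilator, Submodule.mem_comap, Submodule.mem_map,
    forall_exists_index, and_imp, forall_apply_eq_imp_iff₂, LinearMap.dualMap_apply]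

theorem map_dualMap_span_shuffleEquations (h : ℓ + m = n) {T B : Matrix (Fin n) (Fin n) F}
    (hT : IsNilpotent T) (hB : IsUnit B) (hTB : T * B = B * Tᵀ) :
    (Submodule.span F (shuffleEquations m T)).map (dualityEquiv h hB).dualMap.toLinearMap
      = Submodule.span F (shuffleEquations ℓ T) := by
  have hann : ((Submodule.span F (shuffleEquations m T)).map
      (dualityEquiv h hB).dualMap.toLinearMap).dualCoannihilator
        = (Submodule.span F (shuffleEquations ℓ T)).dualCoannihilator :=
    (dualCoannihilator_map_dualMap (dualityEquiv h hB).toLinearMap _).trans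
      (Submodule.ext (dualityEquiv_mem_dualCoannihilator_iff h hT hB hTB))
  simpa only [Subspace.dualCoannihilator_dualAnnihilator_eq]
    using congrArg Submodule.dualAnnihilator hann

end Shuffle

section BlockForm

section Congruence

variable {ι R : Type*} [Fintype ι] [CommRing R]

theorem isSymm_mul_mul_transpose {S : Matrix ι ι R} (hS : S.IsSymm) (A : Matrix ι ι R) :
    (A * S * Aᵀ).IsSymm := by
  rw [Matrix.IsSymm, transpose_mul, transpose_mul, transpose_transpose, hS, Matrix.mul_assoc]

variable [DecidableEq ι]

theorem isUnit_mul_mul_transpose {S A : Matrix ι ι R} (hS : IsUnit S) (hA : IsUnit A) :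
    IsUnit (A * S * Aᵀ) :=
  (hA.mul hS).mul ((isUnit_transpose A).2 hA)

theorem conj_mul_congr_eq {J S : Matrix ι ι R} (hJS : J * S = S * Jᵀ) (g : GL ι R) :
    g.1 * J * g⁻¹.1 * (g.1 * S * g.1ᵀ) = g.1 * S * g.1ᵀ * (g.1 * J * g⁻¹.1)ᵀ := by
  have hg : g.1ᵀ * g⁻¹.1ᵀ = 1 := by rw [← transpose_mul, g.inv_mul, transpose_one]
  calc g.1 * J * g⁻¹.1 * (g.1 * S * g.1ᵀ)
      = g.1 * J * (g⁻¹.1 * g.1) * S * g.1ᵀ := by simp only [Matrix.mul_assoc]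
    _ = g.1 * (J * S) * g.1ᵀ := by
        rw [g.inv_mul, Matrix.mul_one, Matrix.mul_assoc g.1 J S]
    _ = g.1 * S * (g.1ᵀ * g⁻¹.1ᵀ) * Jᵀ * g.1ᵀ := by
        rw [hJS, hg, Matrix.mul_one, Matrix.mul_assoc g.1 S Jᵀ]
    _ = g.1 * S * g.1ᵀ * (g.1 * J * g⁻¹.1)ᵀ := by
        simp only [transpose_mul, Matrix.mul_assoc]

end Congruence

variable (K : Type*) [Field K] (m : ℕ) {n : ℕ} (lam : n.Partition)

theorem antidiagonalBlock_eq_submatrix_one :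
    antidiagonalBlock K m = (1 : Matrix (Fin m) (Fin m) K).submatrix Fin.rev id := by
  ext i j
  simp only [antidiagonalBlock, of_apply, submatrix_apply, Matrix.one_apply, id_eq, Fin.ext_iff,
    Fin.val_rev]
  exact if_congr (by omega) rfl rfl

theorem antidiagonalBlock_isSymm : (antidiagonalBlock K m).IsSymm := by
  ext i j
  simp only [transpose_apply, antidiagonalBlock, of_apply, add_comm (i : ℕ)]

theorem antidiagonalBlock_mul (A : Matrix (Fin m) (Fin m) K) :
    antidiagonalBlock K m * A = A.submatrix Fin.rev id := by
  rw [antidiagonalBlock_eq_submatrix_one]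
  exact one_submatrix_mul Fin.revPerm (Equiv.refl _) A

theorem mul_antidiagonalBlock (A : Matrix (Fin m) (Fin m) K) :
    A * antidiagonalBlock K m = A.submatrix id Fin.rev := by
  rw [← transpose_transpose (A * _), transpose_mul, antidiagonalBlock_isSymm,
    antidiagonalBlock_mul, transpose_submatrix, transpose_transpose]

theorem antidiagonalBlock_mul_self : antidiagonalBlock K m * antidiagonalBlock K m = 1 := by
  rw [antidiagonalBlock_mul, antidiagonalBlock_eq_submatrix_one, submatrix_submatrix,
    Fin.rev_involutive.comp_self, Function.comp_id, submatrix_id_id]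

theorem jordanBlock_mul_antidiagonalBlock :
    jordanBlock K m * antidiagonalBlock K m = antidiagonalBlock K m * (jordanBlock K m)ᵀ := by
  rw [antidiagonalBlock_mul, mul_antidiagonalBlock]
  ext i j
  simp only [jordanBlock, submatrix_apply, transpose_apply, of_apply, id_eq, Fin.val_rev]
  exact if_congr (by omega) rfl rfl

theorem blockAntidiagonal_isSymm : (blockAntidiagonal K lam).IsSymm := by
  rw [Matrix.IsSymm, blockAntidiagonal, transpose_reindex, blockDiagonal'_transpose]
  simp only [(antidiagonalBlock_isSymm K _).eq]

theorem blockAntidiagonal_mul_self : blockAntidiagonal K lam * blockAntidiagonal K lam = 1 := by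
  simp only [blockAntidiagonal, reindex_apply]
  rw [submatrix_mul_equiv, ← blockDiagonal'_mul]
  simp only [antidiagonalBlock_mul_self]
  rw [← Pi.one_def, blockDiagonal'_one, submatrix_one_equiv]

theorem jordanNilpotent_mul_blockAntidiagonal :
    jordanNilpotent K lam * blockAntidiagonal K lam
      = blockAntidiagonal K lam * (jordanNilpotent K lam)ᵀ := by
  simp only [blockAntidiagonal, jordanNilpotent, reindex_apply, transpose_submatrix,
    submatrix_mul_equiv, blockDiagonal'_transpose, ← blockDiagonal'_mul,
    jordanBlock_mul_antidiagonalBlock]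

end BlockForm

section JordanBasis

open Polynomial Module

variable {R ι V W : Type*} [CommRing R] [AddCommGroup V] [Module R V] [AddCommGroup W]
  [Module R W] {k : ι → ℕ}

/-- A Jordan basis of a nilpotent endomorphism: the vectors `b ⟨i, 0⟩, …, b ⟨i, k i - 1⟩` form a
chain along which `f` shifts by one step, sending the last vector to `0`. Chains may be empty. -/
def IsJordanBasis (f : End R V) (b : Basis (Σ i, Fin (k i)) R V) : Prop :=
  ∀ i (j : Fin (k i)), f (b ⟨i, j⟩) = if h : (j : ℕ) + 1 < k i then b ⟨i, ⟨j + 1, h⟩⟩ else 0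

theorem IsJordanBasis.map {f : End R V} {g : End R W} {b : Basis (Σ i, Fin (k i)) R V}
    (hb : IsJordanBasis f b) (e : V ≃ₗ[R] W) (he : ∀ v, e (f v) = g (e v)) :
    IsJordanBasis g (b.map e) := by
  intro i j
  rw [Basis.map_apply, ← he, hb]
  split_ifs with h
  · rw [Basis.map_apply]
  · exact map_zero e

theorem exists_basis_quotient_X_pow (R : Type*) [CommRing R] [Nontrivial R] (k : ℕ) :
    ∃ b : Basis (Fin k) R (R[X] ⧸ Submodule.span R[X] {(X : R[X]) ^ k}),
      ∀ j, b j = Submodule.Quotient.mk (X ^ (j : ℕ)) := by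
  let pb : PowerBasis R (AdjoinRoot (X ^ k : R[X])) := AdjoinRoot.powerBasis' (monic_X_pow k)
  have hdim : pb.dim = k := natDegree_X_pow k
  refine ⟨pb.basis.reindex (finCongr hdim), fun j => ?_⟩
  change pb.basis.reindex (finCongr hdim) j = AdjoinRoot.mk (X ^ k) (X ^ (j : ℕ))
  rw [Basis.reindex_apply, PowerBasis.basis_eq_pow, AdjoinRoot.powerBasis'_gen, map_pow]
  rfl

theorem exists_isJordanBasis_pi_quotient_X_pow (R : Type*) [CommRing R] [Nontrivial R] [Finite ι]
    (k : ι → ℕ) :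
    ∃ b : Basis (Σ i, Fin (k i)) R (Π i, R[X] ⧸ Submodule.span R[X] {(X : R[X]) ^ k i}),
      IsJordanBasis (Algebra.lsmul R R _ (X : R[X])) b := by
  classical
  cases nonempty_fintype ι
  choose b hb using fun i => exists_basis_quotient_X_pow R (k i)
  refine ⟨Pi.basis b, fun i j => ?_⟩
  have hX : (X : R[X]) • b i j = Submodule.Quotient.mk (X ^ ((j : ℕ) + 1)) := by
    rw [hb, ← Submodule.Quotient.mk_smul, smul_eq_mul, pow_succ']
  simp only [Algebra.lsmul_coe, Pi.basis_apply, ← Pi.single_smul, hX]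
  split_ifs with h
  · rw [hb]
  · have hk : (j : ℕ) + 1 = k i := le_antisymm j.2 (not_lt.1 h)
    rw [hk, (Submodule.Quotient.mk_eq_zero _).2 (Submodule.mem_span_singleton_self _),
      Pi.single_zero]

theorem isTorsion'_aeval'_powers_X {f : End R V} (hf : IsNilpotent f) :
    IsTorsion' (AEval' f) (Submonoid.powers (X : R[X])) := by
  obtain ⟨N, hN⟩ := hf
  refine (Submodule.isTorsion'_powers_iff X).2 fun x => ⟨N, ?_⟩
  obtain ⟨v, rfl⟩ := (AEval'.of f).surjective x
  rw [AEval'.X_pow_smul_of, hN, zero_smul, map_zero]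

theorem exists_isJordanBasis {K : Type*} [Field K] [Module K V] [Module.Finite K V]
    {f : End K V} (hf : IsNilpotent f) :
    ∃ (d : ℕ) (k : Fin d → ℕ) (b : Basis (Σ i, Fin (k i)) K V), IsJordanBasis f b := by
  obtain ⟨d, k, ⟨e⟩⟩ := torsion_by_prime_power_decomposition
    (irreducible_X : Irreducible (X : K[X])) (isTorsion'_aeval'_powers_X hf)
  obtain ⟨b, hb⟩ := exists_isJordanBasis_pi_quotient_X_pow K k
  let E : AEval' f ≃ₗ[K[X]] Π i, K[X] ⧸ Submodule.span K[X] {(X : K[X]) ^ k i} :=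
    e.trans (DirectSum.linearEquivFunOnFintype _ _ _)
  refine ⟨d, k, b.map ((E.restrictScalars K).symm.trans (AEval'.of f).symm), hb.map _ fun v => ?_⟩
  change (AEval'.of f).symm (E.symm ((X : K[X]) • v)) = f ((AEval'.of f).symm (E.symm v))
  rw [map_smul, AEval'.of_symm_X_smul]

variable {κ : Type*} {k' : κ → ℕ}

/-- The reindexing of chains along a bijection `e` between the index set of the lengths `k'` and
that of the nonzero lengths among the `k`. -/
def nonemptyChainEquiv (e : κ ≃ {i // k i ≠ 0}) (he : ∀ x, k (e x) = k' x) :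
    (Σ x, Fin (k' x)) ≃ Σ i, Fin (k i) :=
  (Equiv.sigmaCongrRight fun x => finCongr (he x).symm).trans <|
    (Equiv.sigmaCongrLeft (β := fun i : {i // k i ≠ 0} => Fin (k i)) e).trans <|
      Equiv.sigmaSubtypeEquivOfSubset (fun i => Fin (k i)) (k · ≠ 0) fun _ j => j.pos.ne'

theorem nonemptyChainEquiv_apply (e : κ ≃ {i // k i ≠ 0}) (he : ∀ x, k (e x) = k' x) (x : κ)
    (j : Fin (k' x)) : nonemptyChainEquiv e he ⟨x, j⟩ = ⟨e x, Fin.cast (he x).symm j⟩ :=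
  rfl

theorem IsJordanBasis.reindex {f : End R V} {b : Basis (Σ i, Fin (k i)) R V}
    (hb : IsJordanBasis f b) (e : κ ≃ {i // k i ≠ 0}) (he : ∀ x, k (e x) = k' x) :
    IsJordanBasis f (b.reindex (nonemptyChainEquiv e he).symm) := by
  intro x j
  simp only [Basis.reindex_apply, Equiv.symm_symm, nonemptyChainEquiv_apply, hb (e x), he x,
    Fin.val_cast]
  rfl

end JordanBasis

section JordanForm

open Module

theorem exists_equiv_forall_apply_eq {α β γ : Type*} [Fintype α] [Fintype β] {f : α → γ}
    {g : β → γ} (h : Finset.univ.val.map f = Finset.univ.val.map g) :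
    ∃ e : α ≃ β, ∀ a, g (e a) = f a := by
  classical
  have hfiber (c : γ) : Nonempty ({a // f a = c} ≃ {b // g b = c}) := by
    refine ⟨Fintype.equivOfCardEq ?_⟩
    have hcount := congrArg (Multiset.count c) h
    rw [Multiset.count_map, Multiset.count_map] at hcount
    simpa only [Fintype.card_subtype, Finset.card_def, Finset.filter_val, eq_comm] using hcount
  exact ⟨Equiv.ofFiberEquiv fun c => (hfiber c).some, Equiv.ofFiberEquiv_map _⟩

theorem univ_val_map_part {n : ℕ} (lam : n.Partition) :
    Finset.univ.val.map (part lam) = lam.parts := by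
  rw [Fin.univ_val_map, show List.ofFn (part lam) = sortedParts lam from List.ofFn_get _,
    sortedParts, Multiset.sort_eq]

theorem exists_partition_equiv {ι : Type*} [Fintype ι] {n : ℕ} (k : ι → ℕ) (hk : ∑ i, k i = n) :
    ∃ (lam : n.Partition) (e : Fin (sortedParts lam).length ≃ {i // k i ≠ 0}),
      ∀ x, k (e x) = part lam x := by
  refine ⟨Nat.Partition.ofSums n (Finset.univ.val.map k) hk,
    exists_equiv_forall_apply_eq (g := fun i : {i // k i ≠ 0} => k i) ?_⟩
  rw [univ_val_map_part]
  exact (Multiset.filter_map _ _ _).trans (Finset.univ_val_map_subtype_restrict k (k · ≠ 0)).symm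

variable {K : Type*} [Field K] {n : ℕ}

theorem exists_partition_isJordanBasis {V : Type*} [AddCommGroup V] [Module K V]
    [Module.Finite K V] {f : End K V} (hf : IsNilpotent f) (hn : finrank K V = n) :
    ∃ (lam : n.Partition) (b : Basis (Σ x, Fin (part lam x)) K V), IsJordanBasis f b := by
  obtain ⟨d, k, b, hb⟩ := exists_isJordanBasis hf
  have hk : ∑ i, k i = n := by
    rw [← hn, finrank_eq_card_basis b, Fintype.card_sigma]
    simp only [Fintype.card_fin]
  obtain ⟨lam, e, he⟩ := exists_partition_equiv k hk
  exact ⟨lam, _, hb.reindex e he⟩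

theorem jordanNilpotent_blockIndex (lam : n.Partition) (x : Fin (sortedParts lam).length)
    (j : Fin (part lam x)) :
    jordanNilpotent K lam (blockIndex lam ⟨x, j⟩)
      = if h : (j : ℕ) + 1 < part lam x then Pi.single (blockIndex lam ⟨x, ⟨j + 1, h⟩⟩) 1
        else 0 := by
  funext s
  obtain ⟨⟨y, i⟩, rfl⟩ := (blockIndex lam).surjective s
  rw [jordanNilpotent, reindex_apply, submatrix_apply, Equiv.symm_apply_apply,
    Equiv.symm_apply_apply]
  rcases eq_or_ne x y with rfl | hxy
  · rw [blockDiagonal'_apply_eq, jordanBlock, of_apply]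
    split_ifs with hji h h
    · obtain rfl : i = ⟨j + 1, h⟩ := Fin.ext hji.symm
      rw [Pi.single_eq_same]
    · exact absurd (hji ▸ i.2) h
    · rw [Pi.single_eq_of_ne]
      simpa [Fin.ext_iff, eq_comm] using hji
    · rfl
  · rw [blockDiagonal'_apply_ne _ _ _ hxy]
    split_ifs with h
    · rw [Pi.single_eq_of_ne]
      simpa using fun hyx => absurd hyx.symm hxy
    · rfl

theorem isNilpotent_vecMulLinear {R ι : Type*} [CommRing R] [Fintype ι] [DecidableEq ι]
    {T : Matrix ι ι R} (hT : IsNilpotent T) : IsNilpotent (T.vecMulLinear : End R (ι → R)) := by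
  have hTt : (T.vecMulLinear : End R (ι → R)) = toLin' Tᵀ :=
    LinearMap.ext fun v => (mulVec_transpose T v).symm
  rwa [hTt, isNilpotent_toLin'_iff, isNilpotent_transpose_iff]

theorem IsJordanBasis.mul_eq_jordanNilpotent_mul {lam : n.Partition}
    {T G : Matrix (Fin n) (Fin n) K} {b : Basis (Σ x, Fin (part lam x)) K (Fin n → K)}
    (hb : IsJordanBasis T.vecMulLinear b) (hG : ∀ p, G.row (blockIndex lam p) = b p) :
    G * T = jordanNilpotent K lam * G := by
  funext r
  obtain ⟨⟨x, j⟩, rfl⟩ := (blockIndex lam).surjective r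
  have hrow : G (blockIndex lam ⟨x, j⟩) = b ⟨x, j⟩ := hG _
  rw [mul_apply_eq_vecMul, mul_apply_eq_vecMul, hrow, jordanNilpotent_blockIndex,
    ← vecMulLinear_apply, hb]
  split_ifs with h
  · rw [single_one_vecMul, hG]
  · rw [zero_vecMul]

theorem exists_eq_conj_jordanNilpotent {T : Matrix (Fin n) (Fin n) K} (hT : IsNilpotent T) :
    ∃ (lam : n.Partition) (g : GL (Fin n) K), T = g.1 * jordanNilpotent K lam * g⁻¹.1 := by
  obtain ⟨lam, b, hb⟩ :=
    exists_partition_isJordanBasis (isNilpotent_vecMulLinear hT) (finrank_fin_fun K)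
  obtain ⟨G, hG⟩ : IsUnit (of (b.reindex (blockIndex lam)) : Matrix (Fin n) (Fin n) K) :=
    linearIndependent_rows_iff_isUnit.1 (b.reindex (blockIndex lam)).linearIndependent
  have hrow (p) : G.1.row (blockIndex lam p) = b p := by
    rw [hG]
    exact (b.reindex_apply _ _).trans (congrArg b ((blockIndex lam).symm_apply_apply p))
  refine ⟨lam, G⁻¹, ?_⟩
  rw [inv_inv, Matrix.mul_assoc, ← hb.mul_eq_jordanNilpotent_mul hrow, ← Matrix.mul_assoc,
    G.inv_mul, Matrix.one_mul]

end JordanForm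

end NilpotentGrassmannian

theorem mainTheorem3 {K : Type*} [Field K] {n ℓ : ℕ} (hℓ : ℓ ≤ n)
    (T : Matrix (Fin n) (Fin n) K) (hT : IsNilpotent T) :
    -- `T` has a Jordan canonical form
    (∃ (lam : n.Partition) (g : GL (Fin n) K),
      T = g.1 * jordanNilpotent K lam * g⁻¹.1) ∧
    -- and every Jordan canonical form of `T` gives a symmetric form `B` and a duality
    ∀ (lam : n.Partition) (g : GL (Fin n) K),
      T = g.1 * jordanNilpotent K lam * g⁻¹.1 →
      ∀ B : Matrix (Fin n) (Fin n) K,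
        B = g.1 * blockAntidiagonal K lam * g.1ᵀ →
        -- `T` is self-adjoint for the non-degenerate symmetric form `B`
        B.IsSymm ∧ IsUnit B ∧ T * B = B * Tᵀ ∧
        -- the linear change of coordinates, over `K` and over all its extension fields
        ∀ (F : Type*) [Field F] [Algebra K F] (T' B' : Matrix (Fin n) (Fin n) F),
          T' = T.map (algebraMap K F) → B' = B.map (algebraMap K F) →
          ∃ Φ : (Idx n ℓ → F) ≃ₗ[F]
              (Idx n (n - ℓ) → F),
            (∀ P, Φ P = hodgeStar (Nat.add_sub_of_le hℓ)
              (P ᵥ* wedge ℓ B')) ∧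
            -- it identifies the two fixed point loci
            Projectivization.map Φ.toLinearMap Φ.injective ''
                fixedVariety ℓ T' =
              fixedVariety (n - ℓ) T' ∧
            -- on subspaces it is `L ↦ L^⊥`
            (∃ h : Set.BijOn (orth B')
                (Gr F n ℓ) (Gr F n (n - ℓ)),
              ∀ L : Gr F n ℓ,
                Projectivization.map Φ.toLinearMap Φ.injective
                    (plucker L) =
                  plucker
                    ⟨orth B' L.1, h.mapsTo L.2⟩) ∧
            Set.BijOn (orth B')
              (fixedGr ℓ T')
              (fixedGr (n - ℓ) T') ∧
            -- substituting it carries the span of the shuffle equations onto the other one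
            (Submodule.span F (shuffleEquations (n - ℓ) T')).map
                Φ.dualMap.toLinearMap =
              Submodule.span F (shuffleEquations ℓ T') := by
  refine ⟨exists_eq_conj_jordanNilpotent hT, ?_⟩
  rintro lam g hg B rfl
  set B := g.1 * blockAntidiagonal K lam * g.1ᵀ
  have hs : B.IsSymm := isSymm_mul_mul_transpose (blockAntidiagonal_isSymm K lam) g.1
  have hu : IsUnit B :=
    isUnit_mul_mul_transpose (.of_mul_eq_one _ (blockAntidiagonal_mul_self K lam)) g.isUnit
  have hTB : T * B = B * Tᵀ :=
    hg ▸ conj_mul_congr_eq (jordanNilpotent_mul_blockAntidiagonal K lam) g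
  refine ⟨hs, hu, hTB, ?_⟩
  rintro F _ _ T' B' rfl rfl
  have hT' : IsNilpotent (T.map (algebraMap K F)) := hT.map (algebraMap K F).mapMatrix
  have hs' : (B.map (algebraMap K F)).IsSymm := hs.map _
  have hu' : IsUnit (B.map (algebraMap K F)) := hu.map (algebraMap K F).mapMatrix
  have hTB' : T.map (algebraMap K F) * B.map (algebraMap K F)
      = B.map (algebraMap K F) * (T.map (algebraMap K F))ᵀ := by
    rw [← transpose_map, ← Matrix.map_mul, ← Matrix.map_mul, hTB]
  have h := Nat.add_sub_of_le hℓ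
  exact ⟨dualityEquiv h hu', fun _ => rfl, map_dualityEquiv_fixedVariety h hu' hs' hTB',
    ⟨bijOn_orth_Gr h hu' hs', map_dualityEquiv_plucker h hu'⟩,
    bijOn_orth_fixedGr h hu' hs' hTB', map_dualMap_span_shuffleEquations h hT' hu' hTB'⟩
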